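/- A Boolean inverse semigroup is an inverse semigroup $S$ with zero in which any two compatible elements $a, b$ (that is, $a^{-1}b$ and $ab^{-1}$ are idempotents) have a join with respect to the natural partial order ($a \le b$ if and only if $a = ba^{-1}a$), multiplication distributes over such joins, and the semilattice $\mathsf{E}(S)$ of idempotents is a generalized Boolean algebra with respect to the natural partial order; $S$ is assumed not to be the zero semigroup. It is semisimple if for each $a \in S$ the set $\{x \in S : x \le a\}$ is finite. Let $M_\omega(S)$ be the inverse semigroup of all $\omega \times \omega$ matrices over $S$ with only finitely many non-zero entries such that $a^{-1}b = 0$ for entries $a, b$ in the same row and distinct columns, and $ab^{-1} = 0$ for entries $a, b$ in the same column and distinct rows, with multiplication $(AB)_{ij} = \bigvee_k a_{ik}b_{kj}$. For idempotents $e, f$ write $e \mathrel{\mathscr{D}} f$ if $e = a^{-1}a$ and $f = aa^{-1}$ for some $a$. The type monoid of $S$ is the commutative monoid $\mathsf{T}(S) = \mathsf{E}(M_\omega(S))/\mathscr{D}$ with $[e] + [f] = [e' \vee f']$, where $e' \mathrel{\mathscr{D}} e$, $f' \mathrel{\mathscr{D}} f$ and $e'f' = 0$. **Theorem.** Let $S$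 be a Boolean inverse semigroup, not the zero semigroup. Then the type monoid $\mathsf{T}(S)$ is isomorphic to the free abelian monoid on some non-empty set $X$ if and only if $S$ is semisimple. -/

import Mathlib

universe u v

/-- An inverse semigroup: a semigroup in which every element `a` has a unique inverse `a⁻¹`,
that is, a unique `b` such that `a * b * a = a` and `b * a * b = b`. -/
class InverseSemigroup (S : Type u) extends Semigroup S, Inv S where
  mul_inv_mul : ∀ a : S, a * a⁻¹ * a = a
  inv_mul_inv : ∀ a : S, a⁻¹ * a * a⁻¹ = a⁻¹
  inv_unique : ∀ a b : S, a * b * a = a → b * a * b = b → b = a⁻¹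

namespace InverseSemigroup

section Basic

variable {S : Type u} [InverseSemigroup S]

theorem idem_mul {e f : S} (he : e * e = e) (hf : f * f = f) : (e * f) * (e * f) = e * f := by
  -- the inverse of `e * f` is `f * x * e`, an idempotent
  set x := (e * f)⁻¹ with hx
  have h1 : e * f * x * (e * f) = e * f := mul_inv_mul _
  have h2 : x * (e * f) * x = x := inv_mul_inv _
  have h3 : f * x * e = x := by
    apply inv_unique
    · calc e * f * (f * x * e) * (e * f) = e * (f * f) * x * (e * e) * f := by
            simp only [mul_assoc]
        _ = e * f * x * (e * f) := by rw [he, hf]; simp only [mul_assoc]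
        _ = e * f := h1
    · calc f * x * e * (e * f) * (f * x * e) = f * (x * ((e * e) * (f * f)) * x) * e := by
            simp only [mul_assoc]
        _ = f * x * e := by rw [he, hf, h2]
  have h4 : x * x = x := by
    calc x * x = (f * x * e) * (f * x * e) := by rw [h3]
      _ = f * (x * (e * f) * x) * e := by simp only [mul_assoc]
      _ = x := by rw [h2, h3]
  have h5 : e * f = x⁻¹ := inv_unique _ _ h2 h1
  have h6 : x = x⁻¹ := inv_unique _ _ (by rw [h4, h4]) (by rw [h4, h4])
  rw [h5, ← h6, h4]

theorem idem_comm {e f : S} (he : e * e = e) (hf : f * f = f) : e * f = f * e := by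
  have h1 := idem_mul he hf
  have h2 := idem_mul hf he
  have h3 : e * f = (e * f)⁻¹ := inv_unique _ _ (by rw [h1, h1]) (by rw [h1, h1])
  have h4 : f * e = (e * f)⁻¹ := by
    apply inv_unique
    · calc e * f * (f * e) * (e * f) = e * (f * f) * (e * e) * f := by simp only [mul_assoc]
        _ = (e * f) * (e * f) := by rw [he, hf]; simp only [mul_assoc]
        _ = _ := h1
    · calc f * e * (e * f) * (f * e) = f * (e * e) * (f * f) * e := by simp only [mul_assoc]
        _ = (f * e) * (f * e) := by rw [he, hf]; simp only [mul_assoc]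
        _ = _ := h2
  rw [h3, ← h4]

/-- A regular semigroup with commuting idempotents has unique inverses. -/
theorem eq_inv_of_idem_comm {T : Type u} [Semigroup T]
    (h : ∀ e f : T, e * e = e → f * f = f → e * f = f * e) {a b c : T}
    (h1 : a * b * a = a) (h2 : b * a * b = b) (h3 : a * c * a = a) (h4 : c * a * c = c) :
    b = c := by
  have i1 : (a * b) * (a * b) = a * b := by rw [← mul_assoc, h1]
  have i2 : (b * a) * (b * a) = b * a := by rw [← mul_assoc, h2]
  have i3 : (a * c) * (a * c) = a * c := by rw [← mul_assoc, h3]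
  have i4 : (c * a) * (c * a) = c * a := by rw [← mul_assoc, h4]
  calc b = b * (a * c * a) * b := by rw [h3, h2]
    _ = b * ((a * c) * (a * b)) := by simp only [mul_assoc]
    _ = b * ((a * b) * (a * c)) := by rw [h _ _ i3 i1]
    _ = (b * a * b) * (a * c) := by simp only [mul_assoc]
    _ = (b * a) * (c * a * c) := by rw [h2, h4]; simp only [mul_assoc]
    _ = ((b * a) * (c * a)) * c := by simp only [mul_assoc]
    _ = ((c * a) * (b * a)) * c := by rw [h _ _ i2 i4]
    _ = c * (a * b * a) * c := by simp only [mul_assoc]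
    _ = c := by rw [h1, h4]

theorem inv_inv' (a : S) : a⁻¹⁻¹ = a := (inv_unique _ _ (inv_mul_inv a) (mul_inv_mul a)).symm

theorem idem_d (a : S) : (a⁻¹ * a) * (a⁻¹ * a) = a⁻¹ * a := by
  rw [← mul_assoc, inv_mul_inv]

theorem idem_r (a : S) : (a * a⁻¹) * (a * a⁻¹) = a * a⁻¹ := by
  rw [← mul_assoc, mul_inv_mul]

theorem inv_idem {e : S} (he : e * e = e) : e⁻¹ = e :=
  (inv_unique _ _ (by rw [he, he]) (by rw [he, he])).symm

theorem mul_inv' (a b : S) : (a * b)⁻¹ = b⁻¹ * a⁻¹ := by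
  symm
  apply inv_unique
  · calc a * b * (b⁻¹ * a⁻¹) * (a * b) = a * ((b * b⁻¹) * (a⁻¹ * a)) * b := by
          simp only [mul_assoc]
      _ = a * ((a⁻¹ * a) * (b * b⁻¹)) * b := by rw [idem_comm (idem_r b) (idem_d a)]
      _ = (a * a⁻¹ * a) * (b * b⁻¹ * b) := by simp only [mul_assoc]
      _ = a * b := by rw [mul_inv_mul, mul_inv_mul]
  · calc b⁻¹ * a⁻¹ * (a * b) * (b⁻¹ * a⁻¹) = b⁻¹ * ((a⁻¹ * a) * (b * b⁻¹)) * a⁻¹ := by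
          simp only [mul_assoc]
      _ = b⁻¹ * ((b * b⁻¹) * (a⁻¹ * a)) * a⁻¹ := by rw [idem_comm (idem_r b) (idem_d a)]
      _ = (b⁻¹ * b * b⁻¹) * (a⁻¹ * a * a⁻¹) := by simp only [mul_assoc]
      _ = b⁻¹ * a⁻¹ := by rw [inv_mul_inv, inv_mul_inv]

/-- An idempotent can be moved across an element. -/
theorem idem_mul_eq {e : S} (he : e * e = e) (a : S) : e * a = a * (a⁻¹ * e * a) := by
  calc e * a = e * (a * a⁻¹ * a) := by rw [mul_inv_mul]
    _ = (e * (a * a⁻¹)) * a := by simp only [mul_assoc]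
    _ = ((a * a⁻¹) * e) * a := by rw [idem_comm he (idem_r a)]
    _ = _ := by simp only [mul_assoc]

theorem idem_conj {e : S} (he : e * e = e) (a : S) :
    (a⁻¹ * e * a) * (a⁻¹ * e * a) = a⁻¹ * e * a := by
  calc (a⁻¹ * e * a) * (a⁻¹ * e * a) = a⁻¹ * (e * (a * (a⁻¹ * e * a))) := by
        simp only [mul_assoc]
    _ = a⁻¹ * (e * (e * a)) := by rw [← idem_mul_eq he]
    _ = a⁻¹ * ((e * e) * a) := by simp only [mul_assoc]
    _ = _ := by rw [he, mul_assoc]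

theorem mul_idem_eq {e : S} (he : e * e = e) (a : S) : a * e = (a * e * a⁻¹) * a := by
  calc a * e = (a * a⁻¹ * a) * e := by rw [mul_inv_mul]
    _ = a * ((a⁻¹ * a) * e) := by simp only [mul_assoc]
    _ = a * (e * (a⁻¹ * a)) := by rw [idem_comm he (idem_d a)]
    _ = _ := by simp only [mul_assoc]

theorem idem_conj' {e : S} (he : e * e = e) (a : S) :
    (a * e * a⁻¹) * (a * e * a⁻¹) = a * e * a⁻¹ := by
  have := idem_conj he a⁻¹
  rwa [inv_inv'] at this

theorem le_of_eq_mul {a b e : S} (he : e * e = e) (h : a = b * e) : a = b * (a⁻¹ * a) := by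
  subst h
  rw [mul_inv', inv_idem he]
  calc b * e = (b * b⁻¹ * b) * (e * e) := by rw [mul_inv_mul, he]
    _ = b * ((b⁻¹ * b) * e) * e := by simp only [mul_assoc]
    _ = b * (e * (b⁻¹ * b)) * e := by rw [idem_comm he (idem_d b)]
    _ = _ := by simp only [mul_assoc]

/-- The natural partial order: `a ≤ b` if and only if `a = b * a⁻¹ * a`. -/
instance instPartialOrder : PartialOrder S where
  le a b := a = b * a⁻¹ * a
  le_refl a := (mul_inv_mul a).symm
  le_trans a b c hab hbc := by
    rw [mul_assoc] at hab hbc ⊢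
    refine le_of_eq_mul (idem_mul (idem_d b) (idem_d a)) ?_
    rw [← mul_assoc, ← hbc, ← hab]
  le_antisymm a b hab hba := by
    rw [mul_assoc] at hab hba
    calc a = b * (a⁻¹ * a) := hab
      _ = a * (b⁻¹ * b) * (a⁻¹ * a) := by rw [← hba]
      _ = a * ((b⁻¹ * b) * (a⁻¹ * a)) := by simp only [mul_assoc]
      _ = a * ((a⁻¹ * a) * (b⁻¹ * b)) := by rw [idem_comm (idem_d a) (idem_d b)]
      _ = (a * a⁻¹ * a) * (b⁻¹ * b) := by simp only [mul_assoc]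
      _ = b := by rw [mul_inv_mul, ← hba]

theorem le_def (a b : S) : a ≤ b ↔ a = b * a⁻¹ * a := Iff.rfl

theorem le_iff (a b : S) : a ≤ b ↔ a = b * (a⁻¹ * a) := by rw [le_def, mul_assoc]

theorem mul_idem_le {e : S} (he : e * e = e) (a : S) : a * e ≤ a :=
  (le_iff _ _).2 (le_of_eq_mul he rfl)

theorem idem_mul_le {e : S} (he : e * e = e) (a : S) : e * a ≤ a := by
  rw [idem_mul_eq he]; exact mul_idem_le (idem_conj he a) a

theorem mul_le_left {a b : S} (c : S) (h : a ≤ b) : c * a ≤ c * b := by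
  rw [le_iff] at h
  rw [h, ← mul_assoc]
  exact mul_idem_le (idem_d a) _

theorem eq_idem_mul_of_le {a b : S} (h : a ≤ b) : ∃ e : S, e * e = e ∧ a = e * b := by
  rw [le_iff] at h
  refine ⟨b * (a⁻¹ * a) * b⁻¹, idem_conj' (idem_d a) b, ?_⟩
  rw [← mul_idem_eq (idem_d a)]; exact h

theorem mul_le_right {a b : S} (c : S) (h : a ≤ b) : a * c ≤ b * c := by
  obtain ⟨e, he, rfl⟩ := eq_idem_mul_of_le h
  rw [mul_assoc]
  exact idem_mul_le he _

theorem inv_le_inv {a b : S} (h : a ≤ b) : a⁻¹ ≤ b⁻¹ := by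
  obtain ⟨e, he, rfl⟩ := eq_idem_mul_of_le h
  rw [mul_inv', inv_idem he]
  exact mul_idem_le he _

theorem isLUB_inv {s : Set S} {c : S} (h : IsLUB s c) : IsLUB ((fun a => a⁻¹) '' s) c⁻¹ := by
  constructor
  · rintro _ ⟨a, ha, rfl⟩
    exact inv_le_inv (h.1 ha)
  · intro d hd
    have : c ≤ d⁻¹ := h.2 fun a ha => by
      have := inv_le_inv (hd ⟨a, ha, rfl⟩)
      rwa [inv_inv'] at this
    have := inv_le_inv this
    rwa [inv_inv'] at this

/-- The compatibility relation `a ∼ b`. -/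
def Compatible (a b : S) : Prop :=
  IsIdempotentElem (a⁻¹ * b) ∧ IsIdempotentElem (a * b⁻¹)

/-- `e 𝒟 f`: there is an element with domain `a⁻¹ * a = e` and range `a * a⁻¹ = f`. -/
def DRel (e f : S) : Prop :=
  ∃ a : S, a⁻¹ * a = e ∧ a * a⁻¹ = f

end Basic

/-- The set `E(S)` of idempotents of `S`; it carries the restriction of the natural order. -/
abbrev Idem (S : Type u) [InverseSemigroup S] : Type u := {e : S // IsIdempotentElem e}

/-- `𝒟` as an equivalence relation on the idempotents. -/
def dSetoid (S : Type u) [InverseSemigroup S] : Setoid (Idem S) where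
  r e f := DRel (e : S) (f : S)
  iseqv :=
    { refl := fun e => ⟨e.1, by rw [inv_idem e.2]; exact e.2, by rw [inv_idem e.2]; exact e.2⟩
      symm := by
        rintro e f ⟨a, h1, h2⟩
        exact ⟨a⁻¹, by rw [inv_inv']; exact h2, by rw [inv_inv']; exact h1⟩
      trans := by
        rintro e f g ⟨a, h1, h2⟩ ⟨b, h3, h4⟩
        refine ⟨b * a, ?_, ?_⟩
        · rw [mul_inv']
          calc a⁻¹ * b⁻¹ * (b * a) = a⁻¹ * ((b⁻¹ * b) * a) := by simp only [mul_assoc]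
            _ = a⁻¹ * (a * a⁻¹ * a) := by rw [h3, h2]
            _ = e := by rw [mul_inv_mul, h1]
        · rw [mul_inv']
          calc b * a * (a⁻¹ * b⁻¹) = b * ((a * a⁻¹) * b⁻¹) := by simp only [mul_assoc]
            _ = b * (b⁻¹ * b * b⁻¹) := by rw [h2, h3]
            _ = g := by rw [inv_mul_inv, h4] }

/-- An inverse semigroup is semisimple if for each `a` the set of all elements below `a` in the
natural partial order is finite. -/
def IsSemisimple (S : Type u) [InverseSemigroup S] : Prop :=
  ∀ a : S, {x : S | x ≤ a}.Finite

end InverseSemigroup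

/-- An inverse semigroup with zero. -/
class InverseSemigroupWithZero (S : Type u) extends InverseSemigroup S, SemigroupWithZero S

namespace InverseSemigroup

section WithZero

variable {S : Type u} [InverseSemigroupWithZero S]

/-- The orthogonality relation `a ⟂ b`. -/
def Orthogonal (a b : S) : Prop := a⁻¹ * b = 0 ∧ a * b⁻¹ = 0

theorem inv_zero' : (0 : S)⁻¹ = 0 := inv_idem (zero_mul 0)

theorem zero_le' (a : S) : 0 ≤ a := by rw [le_def, mul_zero]

theorem eq_zero_of_le {a : S} (h : a ≤ 0) : a = 0 := le_antisymm h (zero_le' a)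

theorem inv_eq_zero' {a : S} : a⁻¹ = 0 ↔ a = 0 :=
  ⟨fun h => by rw [← inv_inv' a, h, inv_zero'], fun h => by rw [h, inv_zero']⟩

theorem Orthogonal.symm {a b : S} (h : Orthogonal a b) : Orthogonal b a := by
  constructor
  · rw [← inv_eq_zero', mul_inv', inv_inv', h.1]
  · rw [← inv_eq_zero', mul_inv', inv_inv', h.2]

theorem Orthogonal.compatible {a b : S} (h : Orthogonal a b) : Compatible a b := by
  constructor
  · rw [h.1]; exact zero_mul 0
  · rw [h.2]; exact zero_mul 0

theorem orthogonal_mul_left {a b : S} (c : S) (h : Orthogonal a b) :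
    Orthogonal (c * a) (c * b) := by
  constructor
  · rw [mul_inv']
    calc a⁻¹ * c⁻¹ * (c * b) = a⁻¹ * ((c⁻¹ * c) * b) := by simp only [mul_assoc]
      _ = (a⁻¹ * b) * (b⁻¹ * (c⁻¹ * c) * b) := by
          rw [idem_mul_eq (idem_d c) b]; simp only [mul_assoc]
      _ = 0 := by rw [h.1, zero_mul]
  · rw [mul_inv']
    calc c * a * (b⁻¹ * c⁻¹) = c * (a * b⁻¹) * c⁻¹ := by simp only [mul_assoc]
      _ = 0 := by rw [h.2, mul_zero, zero_mul]

theorem orthogonal_inv {a b : S} (h : Orthogonal a b) : Orthogonal a⁻¹ b⁻¹ := by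
  constructor
  · rw [inv_inv']; exact h.2
  · rw [inv_inv']; exact h.1

theorem orthogonal_mul_right {a b : S} (c : S) (h : Orthogonal a b) :
    Orthogonal (a * c) (b * c) := by
  have := orthogonal_inv (orthogonal_mul_left c⁻¹ (orthogonal_inv h))
  rwa [mul_inv', mul_inv', inv_inv', inv_inv', inv_inv'] at this

theorem isLUB_zero {ι : Type v} [Nonempty ι] {f : ι → S} (h : ∀ i, f i = 0) {c : S}
    (hc : IsLUB (Set.range f) c) : c = 0 := by
  apply eq_zero_of_le
  apply hc.2
  rintro _ ⟨i, rfl⟩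
  rw [h i]

end WithZero

end InverseSemigroup

open InverseSemigroup in
/-- A Boolean inverse semigroup: an inverse semigroup with zero in which compatible elements have
joins, multiplication distributes over such joins, and the idempotents form a (generalized)
Boolean algebra with respect to the natural partial order. -/
class BooleanInverseSemigroup (S : Type u) extends InverseSemigroupWithZero S where
  exists_join : ∀ a b : S, Compatible a b → ∃ c, IsLUB {a, b} c
  mul_join : ∀ a b c x : S, Compatible a b → IsLUB {a, b} c → IsLUB {x * a, x * b} (x * c)
  join_mul : ∀ a b c x : S, Compatible a b → IsLUB {a, b} c → IsLUB {a * x, b * x} (c * x)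
  idem_boolean : ∃ B : GeneralizedBooleanAlgebra (Idem S), ∀ e f : Idem S, B.le e f ↔ (e : S) ≤ (f : S)

namespace InverseSemigroup

/-- Iterated least upper bounds. -/
theorem isLUB_iterate {P : Type u} [Preorder P] {ι κ : Type*} {f : ι → κ → P} {g : ι → P} {c : P}
    (h1 : ∀ i, IsLUB (Set.range (f i)) (g i)) (h2 : IsLUB (Set.range g) c) :
    IsLUB (Set.range fun p : ι × κ => f p.1 p.2) c := by
  constructor
  · rintro _ ⟨⟨i, k⟩, rfl⟩
    exact le_trans ((h1 i).1 ⟨k, rfl⟩) (h2.1 ⟨i, rfl⟩)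
  · intro d hd
    apply h2.2
    rintro _ ⟨i, rfl⟩
    apply (h1 i).2
    rintro _ ⟨k, rfl⟩
    exact hd ⟨(i, k), rfl⟩

/-- Iterated least upper bounds, converse. -/
theorem isLUB_of_iterate {P : Type u} [Preorder P] {ι κ : Type*} {f : ι → κ → P} {g : ι → P}
    {c : P} (h1 : ∀ i, IsLUB (Set.range (f i)) (g i))
    (h2 : IsLUB (Set.range fun p : ι × κ => f p.1 p.2) c) : IsLUB (Set.range g) c := by
  constructor
  · rintro _ ⟨i, rfl⟩
    apply (h1 i).2
    rintro _ ⟨k, rfl⟩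
    exact h2.1 ⟨(i, k), rfl⟩
  · intro d hd
    apply h2.2
    rintro _ ⟨⟨i, k⟩, rfl⟩
    exact le_trans ((h1 i).1 ⟨k, rfl⟩) (hd ⟨i, rfl⟩)

theorem isLUB_swap {P : Type u} [Preorder P] {ι κ : Type*} {f : ι → κ → P} {c : P}
    (h : IsLUB (Set.range fun p : ι × κ => f p.1 p.2) c) :
    IsLUB (Set.range fun p : κ × ι => f p.2 p.1) c := by
  have : (Set.range fun p : κ × ι => f p.2 p.1) = Set.range fun p : ι × κ => f p.1 p.2 := by
    ext x
    constructor
    · rintro ⟨⟨k, i⟩, rfl⟩; exact ⟨(i, k), rfl⟩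
    · rintro ⟨⟨i, k⟩, rfl⟩; exact ⟨(k, i), rfl⟩
  rwa [this]

section Joins

variable {S : Type u} [BooleanInverseSemigroup S]

theorem exists_finset_join {ι : Type v} (f : ι → S) (s : Finset ι)
    (hf : ∀ i ∈ s, ∀ j ∈ s, i ≠ j → Orthogonal (f i) (f j)) :
    ∃ c, IsLUB (f '' s) c ∧ (∀ x, IsLUB ((fun i => x * f i) '' s) (x * c)) ∧
      ∀ x, IsLUB ((fun i => f i * x) '' s) (c * x) := by
  classical
  induction s using Finset.induction_on with
  | empty =>
    have h0 : IsLUB (∅ : Set S) (0 : S) := by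
      constructor
      · intro a ha; exact absurd ha (Set.notMem_empty a)
      · intro d _; exact zero_le' d
    refine ⟨0, ?_, fun x => ?_, fun x => ?_⟩
    · simpa using h0
    · simpa using h0
    · simpa using h0
  | insert a s ha ih =>
    obtain ⟨c, h1, h2, h3⟩ := ih fun i hi j hj hij =>
      hf i (Finset.mem_insert_of_mem hi) j (Finset.mem_insert_of_mem hj) hij
    have hort : Orthogonal (f a) c := by
      have hz : ∀ i ∈ s, Orthogonal (f a) (f i) := fun i hi =>
        hf a (Finset.mem_insert_self a s) i (Finset.mem_insert_of_mem hi)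
          (fun h => ha (h ▸ hi))
      constructor
      · apply eq_zero_of_le
        apply (h2 (f a)⁻¹).2
        rintro _ ⟨i, hi, rfl⟩
        exact le_of_eq (hz i hi).1
      · rw [← inv_eq_zero', mul_inv', inv_inv']
        apply eq_zero_of_le
        apply (h3 (f a)⁻¹).2
        rintro _ ⟨i, hi, rfl⟩
        exact le_of_eq (hz i hi).symm.2
    obtain ⟨d, hd⟩ := BooleanInverseSemigroup.exists_join _ _ hort.compatible
    have key : ∀ (g : ι → S) (p q : S), IsLUB (g '' s) p → IsLUB {g a, p} q →
        IsLUB (g '' (insert a s : Finset ι)) q := by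
      intro g p q hp hq
      rw [Finset.coe_insert, Set.image_insert_eq]
      constructor
      · rintro x (rfl | hx)
        · exact hq.1 (Or.inl rfl)
        · exact le_trans (hp.1 hx) (hq.1 (Or.inr rfl))
      · intro x hx
        apply hq.2
        rintro y (rfl | rfl)
        · exact hx (Or.inl rfl)
        · exact hp.2 fun z hz => hx (Or.inr hz)
    refine ⟨d, key _ _ _ h1 hd, fun x => key _ _ _ (h2 x) ?_, fun x => key _ _ _ (h3 x) ?_⟩
    · exact BooleanInverseSemigroup.mul_join _ _ _ x hort.compatible hd
    · exact BooleanInverseSemigroup.join_mul _ _ _ x hort.compatible hd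

theorem exists_strong_join {ι : Type v} (f : ι → S) (hs : {i | f i ≠ 0}.Finite)
    (hf : ∀ i j, i ≠ j → Orthogonal (f i) (f j)) :
    ∃ c, IsLUB (Set.range f) c ∧ (∀ x, IsLUB (Set.range fun i => x * f i) (x * c)) ∧
      ∀ x, IsLUB (Set.range fun i => f i * x) (c * x) := by
  obtain ⟨c, h1, h2, h3⟩ := exists_finset_join f hs.toFinset fun i _ j _ hij => hf i j hij
  have key : ∀ (g : ι → S) (q : S), (∀ i, f i = 0 → g i = 0) → IsLUB (g '' hs.toFinset) q →
      IsLUB (Set.range g) q := by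
    intro g q hg hq
    constructor
    · rintro _ ⟨i, rfl⟩
      by_cases hi : f i = 0
      · rw [hg i hi]; exact zero_le' q
      · exact hq.1 ⟨i, by simpa using hi, rfl⟩
    · intro d hd
      apply hq.2
      rintro _ ⟨i, _, rfl⟩
      exact hd ⟨i, rfl⟩
  exact ⟨c, key _ _ (fun _ h => h) h1, fun x => key _ _ (fun i h => by rw [h, mul_zero]) (h2 x),
    fun x => key _ _ (fun i h => by rw [h, zero_mul]) (h3 x)⟩

theorem isLUB_mul_left {ι : Type v} {f : ι → S} (hs : {i | f i ≠ 0}.Finite)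
    (hf : ∀ i j, i ≠ j → Orthogonal (f i) (f j)) {c : S} (hc : IsLUB (Set.range f) c) (x : S) :
    IsLUB (Set.range fun i => x * f i) (x * c) := by
  obtain ⟨d, h1, h2, _⟩ := exists_strong_join f hs hf
  rw [hc.unique h1]; exact h2 x

theorem isLUB_mul_right {ι : Type v} {f : ι → S} (hs : {i | f i ≠ 0}.Finite)
    (hf : ∀ i j, i ≠ j → Orthogonal (f i) (f j)) {c : S} (hc : IsLUB (Set.range f) c) (x : S) :
    IsLUB (Set.range fun i => f i * x) (c * x) := by
  obtain ⟨d, h1, _, h3⟩ := exists_strong_join f hs hf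
  rw [hc.unique h1]; exact h3 x

end Joins

end InverseSemigroup

open InverseSemigroup in
/-- A generalized rook matrix over `S` with rows and columns indexed by `ι`. -/
@[ext]
structure RookMatrix (ι : Type v) (S : Type u) [BooleanInverseSemigroup S] where
  entry : ι → ι → S
  row_orthogonal : ∀ i j k, j ≠ k → (entry i j)⁻¹ * entry i k = 0
  col_orthogonal : ∀ i j k, i ≠ j → entry i k * (entry j k)⁻¹ = 0
  finite_support : {p : ι × ι | entry p.1 p.2 ≠ 0}.Finite

namespace RookMatrix

open InverseSemigroup

variable {ι : Type v} {S : Type u} [BooleanInverseSemigroup S]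

theorem terms_orthogonal (A B : RookMatrix ι S) (i j k l : ι) (h : k ≠ l) :
    Orthogonal (A.entry i k * B.entry k j) (A.entry i l * B.entry l j) := by
  constructor
  · rw [mul_inv']
    calc (B.entry k j)⁻¹ * (A.entry i k)⁻¹ * (A.entry i l * B.entry l j)
        = (B.entry k j)⁻¹ * ((A.entry i k)⁻¹ * A.entry i l) * B.entry l j := by
          simp only [mul_assoc]
      _ = 0 := by rw [A.row_orthogonal i k l h, mul_zero, zero_mul]
  · rw [mul_inv']
    calc A.entry i k * B.entry k j * ((B.entry l j)⁻¹ * (A.entry i l)⁻¹)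
        = A.entry i k * (B.entry k j * (B.entry l j)⁻¹) * (A.entry i l)⁻¹ := by
          simp only [mul_assoc]
      _ = 0 := by rw [B.col_orthogonal k l j h, mul_zero, zero_mul]

theorem terms_finite (A B : RookMatrix ι S) (i j : ι) :
    {k | A.entry i k * B.entry k j ≠ 0}.Finite := by
  refine (A.finite_support.image Prod.snd).subset ?_
  intro k hk
  refine ⟨(i, k), fun h => hk ?_, rfl⟩
  have h' : A.entry i k = 0 := h
  rw [h', zero_mul]

theorem exists_mulEntry (A B : RookMatrix ι S) (i j : ι) :
    ∃ c, IsLUB (Set.range fun k => A.entry i k * B.entry k j) c :=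
  let ⟨c, hc, _⟩ := exists_strong_join _ (terms_finite A B i j) (terms_orthogonal A B i j)
  ⟨c, hc⟩

/-- The `(i, j)` entry of the product `A * B`, the orthogonal join `⨁ₖ aᵢₖ bₖⱼ`. -/
noncomputable def mulEntry (A B : RookMatrix ι S) (i j : ι) : S :=
  (exists_mulEntry A B i j).choose

theorem isLUB_mulEntry (A B : RookMatrix ι S) (i j : ι) :
    IsLUB (Set.range fun k => A.entry i k * B.entry k j) (mulEntry A B i j) :=
  (exists_mulEntry A B i j).choose_spec

theorem isLUB_mul_mulEntry (A B : RookMatrix ι S) (i j : ι) (x : S) :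
    IsLUB (Set.range fun k => x * (A.entry i k * B.entry k j)) (x * mulEntry A B i j) :=
  isLUB_mul_left (terms_finite A B i j) (terms_orthogonal A B i j) (isLUB_mulEntry A B i j) x

theorem isLUB_mulEntry_mul (A B : RookMatrix ι S) (i j : ι) (x : S) :
    IsLUB (Set.range fun k => (A.entry i k * B.entry k j) * x) (mulEntry A B i j * x) :=
  isLUB_mul_right (terms_finite A B i j) (terms_orthogonal A B i j) (isLUB_mulEntry A B i j) x

theorem mulEntry_ne_zero {A B : RookMatrix ι S} {i j : ι} (h : mulEntry A B i j ≠ 0) :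
    ∃ k, A.entry i k ≠ 0 ∧ B.entry k j ≠ 0 := by
  by_contra hcon
  apply h
  apply eq_zero_of_le
  apply (isLUB_mulEntry A B i j).2
  rintro _ ⟨k, rfl⟩
  apply le_of_eq
  by_cases hA : A.entry i k = 0
  · simp only [hA, zero_mul]
  · by_cases hB : B.entry k j = 0
    · simp only [hB, mul_zero]
    · exact absurd ⟨k, hA, hB⟩ hcon

/-- The transposed matrix of inverses. -/
def star (A : RookMatrix ι S) : RookMatrix ι S where
  entry i j := (A.entry j i)⁻¹
  row_orthogonal i j k h := by rw [inv_inv']; exact A.col_orthogonal j k i h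
  col_orthogonal i j k h := by rw [inv_inv']; exact A.row_orthogonal k i j h
  finite_support := by
    refine (A.finite_support.image Prod.swap).subset ?_
    rintro ⟨i, j⟩ h
    refine ⟨(j, i), fun h' => h ?_, rfl⟩
    have h'' : A.entry j i = 0 := h'
    simp only [h'', inv_zero']

theorem star_star (A : RookMatrix ι S) : A.star.star = A := by
  ext i j; exact inv_inv' _

theorem star_mulEntry (A B : RookMatrix ι S) (i j : ι) :
    (mulEntry A B j i)⁻¹ = mulEntry B.star A.star i j := by
  have h1 := isLUB_inv (isLUB_mulEntry A B j i)
  refine h1.unique ?_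
  rw [← Set.range_comp]
  have h2 := isLUB_mulEntry B.star A.star i j
  convert h2 using 3 with k
  exact mul_inv' _ _

theorem mulEntry_row (A B : RookMatrix ι S) (i j k : ι) (h : j ≠ k) :
    (mulEntry A B i j)⁻¹ * mulEntry A B i k = 0 := by
  apply eq_zero_of_le
  apply (isLUB_mul_mulEntry A B i k _).2
  rintro _ ⟨l, rfl⟩
  dsimp only
  rw [star_mulEntry]
  apply (isLUB_mulEntry_mul B.star A.star j i _).2
  rintro _ ⟨m, rfl⟩
  apply le_of_eq
  change (B.entry m j)⁻¹ * (A.entry i m)⁻¹ * (A.entry i l * B.entry l k) = 0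
  by_cases hlm : m = l
  · subst hlm
    calc (B.entry m j)⁻¹ * (A.entry i m)⁻¹ * (A.entry i m * B.entry m k)
        = (B.entry m j)⁻¹ * (((A.entry i m)⁻¹ * A.entry i m) * B.entry m k) := by
          simp only [mul_assoc]
      _ = ((B.entry m j)⁻¹ * B.entry m k) *
          ((B.entry m k)⁻¹ * ((A.entry i m)⁻¹ * A.entry i m) * B.entry m k) := by
          rw [idem_mul_eq (idem_d (A.entry i m)) (B.entry m k)]; simp only [mul_assoc]
      _ = 0 := by rw [B.row_orthogonal m j k h, zero_mul]
  · calc (B.entry m j)⁻¹ * (A.entry i m)⁻¹ * (A.entry i l * B.entry l k)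
        = (B.entry m j)⁻¹ * ((A.entry i m)⁻¹ * A.entry i l) * B.entry l k := by
          simp only [mul_assoc]
      _ = 0 := by rw [A.row_orthogonal i m l hlm, mul_zero, zero_mul]

/-- Matrix multiplication: `(A * B)ᵢⱼ = ⨁ₖ aᵢₖ bₖⱼ`. -/
noncomputable instance instMul : Mul (RookMatrix ι S) where
  mul A B :=
    { entry := mulEntry A B
      row_orthogonal := mulEntry_row A B
      col_orthogonal := fun i j k h => by
        have := mulEntry_row B.star A.star k i j h
        rw [← star_mulEntry, ← star_mulEntry, inv_inv'] at this
        exact this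
      finite_support := by
        refine ((A.finite_support.image Prod.fst).prod (B.finite_support.image Prod.snd)).subset ?_
        rintro ⟨i, j⟩ h
        obtain ⟨k, hA, hB⟩ := mulEntry_ne_zero h
        exact ⟨⟨(i, k), hA, rfl⟩, ⟨(k, j), hB, rfl⟩⟩ }

theorem isLUB_mul (A B : RookMatrix ι S) (i j : ι) :
    IsLUB (Set.range fun k => A.entry i k * B.entry k j) ((A * B).entry i j) :=
  isLUB_mulEntry A B i j

theorem mul_entry_eq {A B : RookMatrix ι S} {i j : ι} {c : S}
    (h : IsLUB (Set.range fun k => A.entry i k * B.entry k j) c) : (A * B).entry i j = c :=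
  (isLUB_mul A B i j).unique h

theorem isLUB_mul_mul (A B C : RookMatrix ι S) (i j : ι) :
    IsLUB (Set.range fun p : ι × ι => A.entry i p.2 * B.entry p.2 p.1 * C.entry p.1 j)
      ((A * B * C).entry i j) :=
  isLUB_iterate (f := fun l k => A.entry i k * B.entry k l * C.entry l j)
    (fun l => isLUB_mulEntry_mul A B i l (C.entry l j)) (isLUB_mul (A * B) C i j)

theorem isLUB_mul_mul' (A B C : RookMatrix ι S) (i j : ι) :
    IsLUB (Set.range fun p : ι × ι => A.entry i p.1 * (B.entry p.1 p.2 * C.entry p.2 j))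
      ((A * (B * C)).entry i j) :=
  isLUB_iterate (f := fun k l => A.entry i k * (B.entry k l * C.entry l j))
    (fun k => isLUB_mul_mulEntry B C k j (A.entry i k)) (isLUB_mul A (B * C) i j)

theorem isLUB_single {κ : Type*} {f : κ → S} (i : κ) (h : ∀ j, j ≠ i → f j = 0) :
    IsLUB (Set.range f) (f i) := by
  constructor
  · rintro _ ⟨j, rfl⟩
    by_cases hj : j = i
    · rw [hj]
    · rw [h j hj]; exact zero_le' _
  · intro d hd; exact hd ⟨i, rfl⟩

theorem isLUB_of_zero {κ : Type*} {f : κ → S} (h : ∀ j, f j = 0) :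
    IsLUB (Set.range f) 0 := by
  constructor
  · rintro _ ⟨j, rfl⟩
    rw [h j]
  · intro d _; exact zero_le' d

noncomputable instance instSemigroup : Semigroup (RookMatrix ι S) where
  mul_assoc A B C := by
    ext i j
    refine (isLUB_mul_mul A B C i j).unique ?_
    have h := isLUB_swap (f := fun k l => A.entry i k * (B.entry k l * C.entry l j))
      (isLUB_mul_mul' A B C i j)
    convert h using 3 with p
    exact mul_assoc _ _ _

instance instInv : Inv (RookMatrix ι S) := ⟨star⟩

instance instZero : Zero (RookMatrix ι S) where
  zero :=
    { entry := fun _ _ => 0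
      row_orthogonal := fun _ _ _ _ => mul_zero _
      col_orthogonal := fun _ _ _ _ => zero_mul _
      finite_support := by simp }

theorem inv_entry (A : RookMatrix ι S) (i j : ι) : A⁻¹.entry i j = (A.entry j i)⁻¹ := rfl

theorem zero_entry (i j : ι) : (0 : RookMatrix ι S).entry i j = 0 := rfl

theorem mul_star_mul (A : RookMatrix ι S) : A * A⁻¹ * A = A := by
  ext i j
  refine (isLUB_mul_mul A A⁻¹ A i j).unique ?_
  have h := isLUB_single
    (f := fun p : ι × ι => A.entry i p.2 * A⁻¹.entry p.2 p.1 * A.entry p.1 j) (i, j) ?_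
  · simpa only [inv_entry, InverseSemigroup.mul_inv_mul] using h
  · rintro ⟨l, k⟩ hne
    dsimp only
    rw [inv_entry]
    by_cases hk : k = j
    · by_cases hl : i = l
      · exact absurd (by rw [hk, hl]) hne
      · rw [A.col_orthogonal i l k hl, zero_mul]
    · rw [mul_assoc, A.row_orthogonal l k j hk, mul_zero]

theorem idem_entry {E : RookMatrix ι S} (h : E * E = E) (i j : ι) (hij : i ≠ j) :
    E.entry i j = 0 := by
  have h1 := isLUB_mul E E i j
  rw [h] at h1
  apply eq_zero_of_le
  apply h1.2
  rintro _ ⟨k, rfl⟩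
  apply le_of_eq
  dsimp only
  have hle : E.entry i k * E.entry k j ≤ E.entry i j := h1.1 ⟨k, rfl⟩
  set t := E.entry i k * E.entry k j with ht
  by_cases hk : k = i
  · -- then the column `k` differs from `j`, so the ranges are orthogonal
    have hkj : k ≠ j := fun hh => hij (hk ▸ hh)
    obtain ⟨e, he, h2⟩ := eq_idem_mul_of_le hle
    have h3 : (E.entry i k)⁻¹ * t = 0 := by
      rw [h2, idem_mul_eq he, ← mul_assoc, E.row_orthogonal i k j hkj, zero_mul]
    rw [ht, ← InverseSemigroup.mul_inv_mul (E.entry i k)]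
    calc E.entry i k * (E.entry i k)⁻¹ * E.entry i k * E.entry k j
        = E.entry i k * ((E.entry i k)⁻¹ * t) := by rw [ht]; simp only [mul_assoc]
      _ = 0 := by rw [h3, mul_zero]
  · have h2 := (le_iff _ _).1 hle
    have h3 : t * (E.entry k j)⁻¹ = 0 := by
      rw [h2, mul_idem_eq (idem_d t), mul_assoc, E.col_orthogonal i k j (Ne.symm hk), mul_zero]
    calc t = E.entry i k * (E.entry k j * (E.entry k j)⁻¹ * E.entry k j) := by
          rw [InverseSemigroup.mul_inv_mul]
      _ = t * (E.entry k j)⁻¹ * E.entry k j := by rw [ht]; simp only [mul_assoc]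
      _ = 0 := by rw [h3, zero_mul]

theorem mul_diag {D : RookMatrix ι S} (hD : ∀ i j, i ≠ j → D.entry i j = 0) (A : RookMatrix ι S)
    (i j : ι) : (A * D).entry i j = A.entry i j * D.entry j j :=
  mul_entry_eq <| isLUB_single (f := fun k => A.entry i k * D.entry k j) j fun k hk => by
    rw [hD k j hk, mul_zero]

theorem diag_mul {D : RookMatrix ι S} (hD : ∀ i j, i ≠ j → D.entry i j = 0) (A : RookMatrix ι S)
    (i j : ι) : (D * A).entry i j = D.entry i i * A.entry i j :=
  mul_entry_eq <| isLUB_single (f := fun k => D.entry i k * A.entry k j) i fun k hk => by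
    rw [hD i k (Ne.symm hk), zero_mul]

theorem idem_entry_diag {E : RookMatrix ι S} (h : E * E = E) (i : ι) :
    E.entry i i * E.entry i i = E.entry i i := by
  rw [← mul_diag (idem_entry h), h]

theorem idem_iff (E : RookMatrix ι S) : E * E = E ↔
    (∀ i j, i ≠ j → E.entry i j = 0) ∧ ∀ i, E.entry i i * E.entry i i = E.entry i i := by
  refine ⟨fun h => ⟨idem_entry h, idem_entry_diag h⟩, fun ⟨h1, h2⟩ => ?_⟩
  ext i j
  rw [mul_diag h1]
  by_cases hij : i = j
  · rw [hij, h2]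
  · rw [h1 i j hij, zero_mul]

theorem idem_commute (E F : RookMatrix ι S) (hE : E * E = E) (hF : F * F = F) :
    E * F = F * E := by
  ext i j
  rw [mul_diag (idem_entry hF), diag_mul (idem_entry hF)]
  by_cases hij : i = j
  · subst hij
    exact idem_comm (idem_entry_diag hE i) (idem_entry_diag hF i)
  · rw [idem_entry hE i j hij, zero_mul, mul_zero]

/-- The inverse semigroup (with zero) of rook matrices over `S`. -/
noncomputable instance instInverseSemigroupWithZero :
    InverseSemigroupWithZero (RookMatrix ι S) where
  mul_inv_mul := mul_star_mul
  inv_mul_inv A := by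
    have := mul_star_mul A⁻¹
    rwa [show A⁻¹⁻¹ = A from star_star A] at this
  inv_unique A B h1 h2 := by
    refine eq_inv_of_idem_comm idem_commute h1 h2 (mul_star_mul A) ?_
    have := mul_star_mul A⁻¹
    rwa [show A⁻¹⁻¹ = A from star_star A] at this
  zero_mul A := by
    ext i j
    exact mul_entry_eq (isLUB_of_zero fun k => zero_mul _)
  mul_zero A := by
    ext i j
    exact mul_entry_eq (isLUB_of_zero fun k => mul_zero _)

theorem le_iff_entry (A B : RookMatrix ι S) : A ≤ B ↔ ∀ i j, A.entry i j ≤ B.entry i j := by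
  constructor
  · intro h i j
    rw [le_iff] at h
    have hd := idem_d A
    rw [h, mul_diag (idem_entry hd)]
    exact mul_idem_le (idem_entry_diag hd j) _
  · intro h
    rw [le_def]
    ext i j
    refine IsLUB.unique ?_ (isLUB_mul_mul B A⁻¹ A i j)
    have h1 := isLUB_single
      (f := fun p : ι × ι => B.entry i p.2 * A⁻¹.entry p.2 p.1 * A.entry p.1 j) (i, j) ?_
    · dsimp only at h1
      rwa [inv_entry, ← (le_def _ _).1 (h i j)] at h1
    · rintro ⟨l, k⟩ hne
      dsimp only
      rw [inv_entry]
      by_cases hk : k = j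
      · by_cases hl : i = l
        · exact absurd (by rw [hk, hl]) hne
        · obtain ⟨e, he, h2⟩ := eq_idem_mul_of_le (h l k)
          rw [h2, mul_inv', ← mul_assoc, B.col_orthogonal i l k hl, zero_mul, zero_mul]
      · rw [mul_assoc, A.row_orthogonal l k j hk, mul_zero]

theorem orthogonal_entry {A B : RookMatrix ι S} (h : Orthogonal A B) :
    (∀ i j k, (A.entry i j)⁻¹ * B.entry i k = 0) ∧
      ∀ i j k, A.entry i k * (B.entry j k)⁻¹ = 0 := by
  constructor
  · intro i j k
    have h1 := isLUB_mul A⁻¹ B j k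
    rw [h.1] at h1
    exact eq_zero_of_le (h1.1 ⟨i, rfl⟩)
  · intro i j k
    have h1 := isLUB_mul A B⁻¹ i j
    rw [h.2] at h1
    exact eq_zero_of_le (h1.1 ⟨k, rfl⟩)

theorem isLUB_of_entry {A B C : RookMatrix ι S}
    (h : ∀ i j, IsLUB {A.entry i j, B.entry i j} (C.entry i j)) : IsLUB {A, B} C := by
  constructor
  · rintro X (rfl | rfl)
    · exact (le_iff_entry _ _).2 fun i j => (h i j).1 (Or.inl rfl)
    · exact (le_iff_entry _ _).2 fun i j => (h i j).1 (Or.inr rfl)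
  · intro D hD
    refine (le_iff_entry _ _).2 fun i j => (h i j).2 ?_
    rintro x (rfl | rfl)
    · exact (le_iff_entry _ _).1 (hD (Or.inl rfl)) i j
    · exact (le_iff_entry _ _).1 (hD (Or.inr rfl)) i j

theorem pair_le_zero {x y c : S} (h : IsLUB {x, y} c) (hx : x = 0) (hy : y = 0) : c = 0 := by
  apply eq_zero_of_le
  apply h.2
  rintro z (rfl | rfl)
  · exact le_of_eq hx
  · exact le_of_eq hy

theorem exists_entry_join {A B : RookMatrix ι S} (h : Orthogonal A B) :
    ∃ C : RookMatrix ι S, ∀ i j, IsLUB {A.entry i j, B.entry i j} (C.entry i j) := by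
  obtain ⟨h1, h2⟩ := orthogonal_entry h
  have hort : ∀ i j, Orthogonal (A.entry i j) (B.entry i j) := fun i j => ⟨h1 i j j, h2 i i j⟩
  have h1' : ∀ i j k, (B.entry i j)⁻¹ * A.entry i k = 0 := (orthogonal_entry h.symm).1
  have h2' : ∀ i j k, B.entry i k * (A.entry j k)⁻¹ = 0 := (orthogonal_entry h.symm).2
  choose c hc using fun i j => BooleanInverseSemigroup.exists_join _ _ (hort i j).compatible
  have hml : ∀ i j x, x * A.entry i j = 0 → x * B.entry i j = 0 → x * c i j = 0 :=
    fun i j x => pair_le_zero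
      (BooleanInverseSemigroup.mul_join _ _ _ x (hort i j).compatible (hc i j))
  have hmr : ∀ i j x, A.entry i j * x = 0 → B.entry i j * x = 0 → c i j * x = 0 :=
    fun i j x => pair_le_zero
      (BooleanInverseSemigroup.join_mul _ _ _ x (hort i j).compatible (hc i j))
  have hinv : ∀ x y : S, x⁻¹ * y = 0 → y⁻¹ * x = 0 := fun x y hh => by
    rw [← inv_eq_zero', mul_inv', inv_inv', hh]
  have hinv' : ∀ x y : S, x * y⁻¹ = 0 → y * x⁻¹ = 0 := fun x y hh => by
    rw [← inv_eq_zero', mul_inv', inv_inv', hh]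
  refine ⟨⟨c, fun i j k hjk => ?_, fun i j k hij => ?_, ?_⟩, hc⟩
  · apply hml
    · apply hinv; exact hml i j _ (A.row_orthogonal i k j hjk.symm) (h1 i k j)
    · apply hinv; exact hml i j _ (h1' i k j) (B.row_orthogonal i k j hjk.symm)
  · apply hmr
    · apply hinv'; exact hmr j k _ (A.col_orthogonal j i k hij.symm) (h2' j i k)
    · apply hinv'; exact hmr j k _ (h2 j i k) (B.col_orthogonal j i k hij.symm)
  · refine (A.finite_support.union B.finite_support).subset ?_
    rintro ⟨i, j⟩ hij
    by_contra hcon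
    rw [Set.mem_union, not_or] at hcon
    exact hij (pair_le_zero (hc i j) (not_not.1 hcon.1) (not_not.1 hcon.2))

/-- Orthogonal rook matrices have a join. -/
theorem exists_join {A B : RookMatrix ι S} (h : Orthogonal A B) :
    ∃ C : RookMatrix ι S, IsLUB {A, B} C :=
  let ⟨C, hC⟩ := exists_entry_join h
  ⟨C, isLUB_of_entry hC⟩

/-- Multiplication distributes over orthogonal joins of rook matrices. -/
theorem mul_join {A B C : RookMatrix ι S} (h : Orthogonal A B) (hC : IsLUB {A, B} C)
    (D : RookMatrix ι S) : IsLUB {D * A, D * B} (D * C) := by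
  obtain ⟨C', hC'⟩ := exists_entry_join h
  obtain rfl := hC.unique (isLUB_of_entry hC')
  obtain ⟨h1, h2⟩ := orthogonal_entry h
  apply isLUB_of_entry
  intro i j
  have hb : ∀ x y : S, ({x, y} : Set S) = Set.range (fun b : Bool => cond b x y) := by
    intro x y
    ext z
    constructor
    · rintro (rfl | rfl)
      · exact ⟨true, rfl⟩
      · exact ⟨false, rfl⟩
    · rintro ⟨b, rfl⟩
      cases b
      · exact Or.inr rfl
      · exact Or.inl rfl
  have h3 : ∀ k, IsLUB (Set.range fun b : Bool =>
      cond b (D.entry i k * A.entry k j) (D.entry i k * B.entry k j))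
      (D.entry i k * C.entry k j) := fun k => by
    rw [← hb]
    have hort : Orthogonal (A.entry k j) (B.entry k j) := ⟨h1 k j j, h2 k k j⟩
    exact BooleanInverseSemigroup.mul_join _ _ _ _ hort.compatible (hC' k j)
  have h4 := isLUB_swap (f := fun k (b : Bool) =>
    cond b (D.entry i k * A.entry k j) (D.entry i k * B.entry k j))
    (isLUB_iterate h3 (isLUB_mul D C i j))
  rw [hb]
  refine isLUB_of_iterate (f := fun (b : Bool) k =>
    cond b (D.entry i k * A.entry k j) (D.entry i k * B.entry k j)) ?_ h4
  rintro (_ | _)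
  · exact isLUB_mul D B i j
  · exact isLUB_mul D A i j

theorem join_mul {A B C : RookMatrix ι S} (h : Orthogonal A B) (hC : IsLUB {A, B} C)
    (D : RookMatrix ι S) : IsLUB {A * D, B * D} (C * D) := by
  have h1 := isLUB_inv hC
  rw [Set.image_pair] at h1
  have h2 := isLUB_inv (mul_join (orthogonal_inv h) h1 D⁻¹)
  rw [Set.image_pair] at h2
  simpa only [mul_inv', inv_inv'] using h2

theorem join_idem {E F G : RookMatrix ι S} (hE : E * E = E) (hF : F * F = F)
    (h : Orthogonal E F) (hG : IsLUB {E, F} G) : G * G = G := by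
  have hEF : E * F = 0 := by have := h.1; rwa [inv_idem hE] at this
  have hFE : F * E = 0 := by rw [idem_commute F E hF hE, hEF]
  have hz : ∀ A : RookMatrix ι S, IsLUB {A, 0} A := fun A => by
    constructor
    · rintro _ (rfl | rfl)
      · exact le_rfl
      · exact zero_le' _
    · intro B hB; exact hB (Or.inl rfl)
  have h1 : G * E = E := by
    have h3 := join_mul h hG E
    rw [hE, hFE] at h3
    exact h3.unique (hz E)
  have h2 : G * F = F := by
    have h3 := join_mul h hG F
    rw [hF, hEF, Set.pair_comm] at h3
    exact h3.unique (hz F)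
  have h3 := mul_join h hG G
  rw [h1, h2] at h3
  exact h3.unique hG

theorem orthogonal_idem_iff {E F : RookMatrix ι S} (hE : E * E = E) (hF : F * F = F) :
    Orthogonal E F ↔ E * F = 0 := by
  rw [Orthogonal, inv_idem hE, inv_idem hF, and_self]

theorem orthogonal_idem_diag {E F : RookMatrix ι S} (hE : E * E = E) (hF : F * F = F)
    (h : ∀ i, E.entry i i = 0 ∨ F.entry i i = 0) : Orthogonal E F := by
  rw [orthogonal_idem_iff hE hF]
  ext i j
  rw [mul_diag (idem_entry hF), zero_entry]
  by_cases hij : i = j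
  · subst hij
    rcases h i with h | h
    · rw [h, zero_mul]
    · rw [h, mul_zero]
  · rw [idem_entry hE i j hij, zero_mul]

/-- Moving a diagonal matrix along an injection gives a `𝒟`-related one. -/
theorem exists_shift (E : Idem (RookMatrix ι S)) (φ : ι → ι) (hφ : Function.Injective φ) :
    ∃ F : Idem (RookMatrix ι S), DRel (E : RookMatrix ι S) F ∧
      ∀ i, (∀ j, φ j ≠ i) → F.1.entry i i = 0 := by
  classical
  have hE : E.1 * E.1 = E.1 := E.2
  let P : RookMatrix ι S :=
    { entry := fun i j => if i = φ j then E.1.entry j j else 0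
      row_orthogonal := by
        intro i j k hjk
        by_cases h1 : i = φ j
        · have h2 : i ≠ φ k := fun h => hjk (hφ (h1 ▸ h))
          rw [if_neg h2, mul_zero]
        · rw [if_neg h1, inv_zero', zero_mul]
      col_orthogonal := by
        intro i j k hij
        by_cases h1 : i = φ k
        · have h2 : j ≠ φ k := fun h => hij (h1.trans h.symm)
          rw [if_neg h2, inv_zero', mul_zero]
        · rw [if_neg h1, zero_mul]
      finite_support := by
        refine (E.1.finite_support.image fun p => (φ p.1, p.2)).subset ?_
        rintro ⟨i, j⟩ h
        have h' : (if i = φ j then E.1.entry j j else 0) ≠ 0 := h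
        by_cases h1 : i = φ j
        · rw [if_pos h1] at h'
          exact ⟨(j, j), h', by rw [h1]⟩
        · rw [if_neg h1] at h'
          exact absurd rfl h' }
  have hP : ∀ i j, P.entry i j = if i = φ j then E.1.entry j j else 0 := fun _ _ => rfl
  refine ⟨⟨P * P⁻¹, idem_r P⟩, ⟨P, ?_, rfl⟩, ?_⟩
  · ext i j
    refine mul_entry_eq ?_
    by_cases hij : i = j
    · subst hij
      have h1 := isLUB_single (f := fun k => P⁻¹.entry i k * P.entry k i) (φ i) fun k hk => by
        rw [hP, if_neg hk, mul_zero]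
      rwa [inv_entry, hP, if_pos rfl, inv_idem (idem_entry_diag hE i), idem_entry_diag hE i] at h1
    · rw [idem_entry hE i j hij]
      exact isLUB_of_zero fun k => P.row_orthogonal k i j hij
  · intro i hi
    refine mul_entry_eq (isLUB_of_zero fun k => ?_)
    rw [hP, if_neg (Ne.symm (hi k)), zero_mul]

end RookMatrix

open InverseSemigroup in
/-- The type monoid `T(S) = E(M_ω(S)) / 𝒟`, where `M_ω(S)` is the inverse semigroup of all
`ω × ω` rook matrices over `S`. -/
def TypeMonoid (S : Type u) [BooleanInverseSemigroup S] : Type u :=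
  Quotient (dSetoid (RookMatrix ℕ S))

namespace TypeMonoid

open InverseSemigroup RookMatrix

variable {S : Type u} [BooleanInverseSemigroup S]

/-- The class `[e]` of an idempotent rook matrix. -/
noncomputable def mk (e : Idem (RookMatrix ℕ S)) : TypeMonoid S := Quotient.mk (dSetoid (RookMatrix ℕ S)) e

theorem mk_eq_iff {e f : Idem (RookMatrix ℕ S)} :
    mk e = mk f ↔ DRel (e : RookMatrix ℕ S) (f : RookMatrix ℕ S) :=
  ⟨fun h => Quotient.exact (s := dSetoid (RookMatrix ℕ S)) h,
    fun h => Quotient.sound (s := dSetoid (RookMatrix ℕ S)) h⟩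

/-- `z = [e ∨ f]` for some orthogonal idempotents with `x = [e]` and `y = [f]`. -/
def IsSum (x y z : TypeMonoid S) : Prop :=
  ∃ e f g : Idem (RookMatrix ℕ S), Orthogonal (e : RookMatrix ℕ S) f ∧
    IsLUB {(e : RookMatrix ℕ S), (f : RookMatrix ℕ S)} g ∧ mk e = x ∧ mk f = y ∧ mk g = z

theorem exists_reps (x y z : TypeMonoid S) : ∃ e f g : Idem (RookMatrix ℕ S),
    mk e = x ∧ mk f = y ∧ mk g = z ∧ Orthogonal (e : RookMatrix ℕ S) f ∧
      Orthogonal (e : RookMatrix ℕ S) g ∧ Orthogonal (f : RookMatrix ℕ S) g := by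
  obtain ⟨e, rfl⟩ := Quotient.exists_rep x
  obtain ⟨f, rfl⟩ := Quotient.exists_rep y
  obtain ⟨g, rfl⟩ := Quotient.exists_rep z
  obtain ⟨e', he, he'⟩ := exists_shift e (fun n => 3 * n) (fun a b h => by dsimp only at h; omega)
  obtain ⟨f', hf, hf'⟩ := exists_shift f (fun n => 3 * n + 1)
    (fun a b h => by dsimp only at h; omega)
  obtain ⟨g', hg, hg'⟩ := exists_shift g (fun n => 3 * n + 2)
    (fun a b h => by dsimp only at h; omega)
  refine ⟨e', f', g', (mk_eq_iff.2 he).symm, (mk_eq_iff.2 hf).symm, (mk_eq_iff.2 hg).symm,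
    orthogonal_idem_diag e'.2 f'.2 fun i => ?_, orthogonal_idem_diag e'.2 g'.2 fun i => ?_,
    orthogonal_idem_diag f'.2 g'.2 fun i => ?_⟩
  · by_cases h : i % 3 = 0
    · right; exact hf' i fun j => by omega
    · left; exact he' i fun j => by omega
  · by_cases h : i % 3 = 0
    · right; exact hg' i fun j => by omega
    · left; exact he' i fun j => by omega
  · by_cases h : i % 3 = 1
    · right; exact hg' i fun j => by omega
    · left; exact hf' i fun j => by omega

theorem exists_idem_join {e f : Idem (RookMatrix ℕ S)} (h : Orthogonal (e : RookMatrix ℕ S) f) :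
    ∃ g : Idem (RookMatrix ℕ S), IsLUB {(e : RookMatrix ℕ S), (f : RookMatrix ℕ S)} g :=
  let ⟨g, hg⟩ := RookMatrix.exists_join h
  ⟨⟨g, join_idem e.2 f.2 h hg⟩, hg⟩

theorem exists_isSum (x y : TypeMonoid S) : ∃ z, IsSum x y z := by
  obtain ⟨e, f, _, he, hf, _, hef, _, _⟩ := exists_reps x y y
  obtain ⟨g, hg⟩ := exists_idem_join hef
  exact ⟨mk g, e, f, g, hef, hg, he, hf, rfl⟩

theorem domain_join {A B C e f g : RookMatrix ℕ S} (h : Orthogonal A B) (hC : IsLUB {A, B} C)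
    (he : A⁻¹ * A = e) (hf : B⁻¹ * B = f) (hg : IsLUB {e, f} g) : C⁻¹ * C = g := by
  have hz : ∀ A : RookMatrix ℕ S, IsLUB {A, 0} A := fun A => by
    constructor
    · rintro _ (rfl | rfl)
      · exact le_rfl
      · exact zero_le' _
    · intro B hB; exact hB (Or.inl rfl)
  have hi := isLUB_inv hC
  rw [Set.image_pair] at hi
  have h1 : C⁻¹ * A = e := by
    have := RookMatrix.join_mul (orthogonal_inv h) hi A
    rw [he, h.symm.1] at this
    exact this.unique (hz e)
  have h2 : C⁻¹ * B = f := by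
    have := RookMatrix.join_mul (orthogonal_inv h) hi B
    rw [hf, h.1, Set.pair_comm] at this
    exact this.unique (hz f)
  have h3 := RookMatrix.mul_join h hC C⁻¹
  rw [h1, h2] at h3
  exact h3.unique hg

theorem isSum_unique {x y z w : TypeMonoid S} (h1 : IsSum x y z) (h2 : IsSum x y w) : z = w := by
  obtain ⟨e, f, g, hef, hg, rfl, rfl, rfl⟩ := h1
  obtain ⟨e', f', g', hef', hg', he, hf, rfl⟩ := h2
  obtain ⟨A, hA1, hA2⟩ := mk_eq_iff.1 he.symm
  obtain ⟨B, hB1, hB2⟩ := mk_eq_iff.1 hf.symm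
  have hefz : (e : RookMatrix ℕ S) * f = 0 := (orthogonal_idem_iff e.2 f.2).1 hef
  have hefz' : (e' : RookMatrix ℕ S) * f' = 0 := (orthogonal_idem_iff e'.2 f'.2).1 hef'
  have hort : Orthogonal A B := by
    constructor
    · calc A⁻¹ * B = (A⁻¹ * A * A⁻¹) * (B * B⁻¹ * B) := by
            rw [InverseSemigroup.inv_mul_inv, InverseSemigroup.mul_inv_mul]
        _ = A⁻¹ * ((A * A⁻¹) * (B * B⁻¹)) * B := by simp only [mul_assoc]
        _ = 0 := by rw [hA2, hB2, hefz', mul_zero, zero_mul]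
    · calc A * B⁻¹ = (A * A⁻¹ * A) * (B⁻¹ * B * B⁻¹) := by
            rw [InverseSemigroup.inv_mul_inv, InverseSemigroup.mul_inv_mul]
        _ = A * ((A⁻¹ * A) * (B⁻¹ * B)) * B⁻¹ := by simp only [mul_assoc]
        _ = 0 := by rw [hA1, hB1, hefz, mul_zero, zero_mul]
  obtain ⟨C, hC⟩ := RookMatrix.exists_join hort
  refine mk_eq_iff.2 ⟨C, domain_join hort hC hA1 hB1 hg, ?_⟩
  have hi := isLUB_inv hC
  rw [Set.image_pair] at hi
  have := domain_join (orthogonal_inv hort) hi (e := e'.1) (f := f'.1)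
    (by rw [inv_inv', hA2]) (by rw [inv_inv', hB2]) hg'
  rwa [inv_inv'] at this

theorem IsSum.symm {x y z : TypeMonoid S} (h : IsSum x y z) : IsSum y x z := by
  obtain ⟨e, f, g, hef, hg, he, hf, hz⟩ := h
  exact ⟨f, e, g, hef.symm, by rwa [Set.pair_comm], hf, he, hz⟩

/-- Addition: `[e] + [f] = [e' ∨ f']` where `e' 𝒟 e`, `f' 𝒟 f` and `e' ⟂ f'`. -/
noncomputable instance instAdd : Add (TypeMonoid S) where
  add x y := (exists_isSum x y).choose

theorem isSum_add (x y : TypeMonoid S) : IsSum x y (x + y) := (exists_isSum x y).choose_spec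

theorem add_eq_iff {x y z : TypeMonoid S} : x + y = z ↔ IsSum x y z :=
  ⟨fun h => h ▸ isSum_add x y, fun h => isSum_unique (isSum_add x y) h⟩

theorem mk_add_mk {e f g : Idem (RookMatrix ℕ S)} (h : Orthogonal (e : RookMatrix ℕ S) f)
    (hg : IsLUB {(e : RookMatrix ℕ S), (f : RookMatrix ℕ S)} g) : mk e + mk f = mk g :=
  add_eq_iff.2 ⟨e, f, g, h, hg, rfl, rfl, rfl⟩

/-- The neutral element is `[0]`. -/
noncomputable instance instZero : Zero (TypeMonoid S) where
  zero := mk ⟨0, zero_mul 0⟩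

theorem zero_def : (0 : TypeMonoid S) = mk ⟨0, zero_mul 0⟩ := rfl

theorem add_comm' (x y : TypeMonoid S) : x + y = y + x :=
  add_eq_iff.2 (isSum_add y x).symm

theorem zero_add' (x : TypeMonoid S) : 0 + x = x := by
  obtain ⟨e, rfl⟩ := Quotient.exists_rep x
  refine mk_add_mk (orthogonal_idem_iff (zero_mul 0) e.2 |>.2 (zero_mul _)) ?_
  constructor
  · rintro _ (rfl | rfl)
    · exact zero_le' _
    · exact le_rfl
  · intro B hB; exact hB (Or.inr rfl)

theorem orthogonal_join {e f g w : Idem (RookMatrix ℕ S)}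
    (hef : Orthogonal (e : RookMatrix ℕ S) f)
    (heg : Orthogonal (e : RookMatrix ℕ S) g) (hfg : Orthogonal (f : RookMatrix ℕ S) g)
    (hw : IsLUB {(e : RookMatrix ℕ S), (f : RookMatrix ℕ S)} w) :
    Orthogonal (w : RookMatrix ℕ S) g := by
  rw [orthogonal_idem_iff w.2 g.2]
  have h1 := RookMatrix.join_mul hef hw g
  rw [(orthogonal_idem_iff e.2 g.2).1 heg, (orthogonal_idem_iff f.2 g.2).1 hfg] at h1
  apply eq_zero_of_le
  apply h1.2
  rintro _ (rfl | rfl) <;> exact le_rfl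

theorem add_assoc' (x y z : TypeMonoid S) : x + y + z = x + (y + z) := by
  obtain ⟨e, f, g, rfl, rfl, rfl, hef, heg, hfg⟩ := exists_reps x y z
  obtain ⟨w, hw⟩ := exists_idem_join hef
  obtain ⟨u, hu⟩ := exists_idem_join hfg
  have hwg := orthogonal_join hef heg hfg hw
  have hue := orthogonal_join hfg hef.symm heg.symm hu
  obtain ⟨h, hh⟩ := exists_idem_join hwg
  rw [mk_add_mk hef hw, mk_add_mk hwg hh, mk_add_mk hfg hu, mk_add_mk hue.symm]
  constructor
  · rintro _ (rfl | rfl)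
    · exact le_trans (hw.1 (Or.inl rfl)) (hh.1 (Or.inl rfl))
    · apply hu.2
      rintro _ (rfl | rfl)
      · exact le_trans (hw.1 (Or.inr rfl)) (hh.1 (Or.inl rfl))
      · exact hh.1 (Or.inr rfl)
  · intro b hb
    apply hh.2
    rintro _ (rfl | rfl)
    · apply hw.2
      rintro _ (rfl | rfl)
      · exact hb (Or.inl rfl)
      · exact le_trans (hu.1 (Or.inl rfl)) (hb (Or.inr rfl))
    · exact le_trans (hu.1 (Or.inr rfl)) (hb (Or.inr rfl))

/-- The type monoid is a commutative monoid. -/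
noncomputable instance instAddCommMonoid : AddCommMonoid (TypeMonoid S) where
  add_assoc := add_assoc'
  zero_add := zero_add'
  add_zero x := by rw [add_comm', zero_add']
  add_comm := add_comm'
  nsmul := nsmulRec

end TypeMonoid

/-! The type monoid is always conical (`Subsingleton (AddUnits _)`) and has Riesz refinement. Both
come from `TypeMonoid.exists_split`: if `[e] = y + z`, then `e` itself is an orthogonal join of
idempotents representing `y` and `z`. In a conical refinement monoid a decomposition into
irreducibles is unique, so such a monoid is free on its irreducibles as soon as these generate it
(`nonempty_addEquiv_finsupp`).

If `S` is semisimple, only finitely many rook matrices lie below a given one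
(`RookMatrix.finite_le`). Splitting an idempotent matrix into nonzero orthogonal pieces therefore
terminates, and every class is a sum of irreducibles.

Conversely, an isomorphism with a free monoid turns total degree into a map `μ` from the idempotents
of `S` to `ℕ`, additive on orthogonal joins and vanishing only at `0`. A proper nonzero `f ≤ e` and
its complement in `e` both have smaller measure than `e`, so by induction on `μ e` only finitely
many elements lie below `e` (`isSemisimple_of_measure`). Elements below an arbitrary `a` are
determined by idempotents below `a⁻¹ * a`. -/

/-! ### Unique factorization in conical refinement monoids -/

section RefinementMonoid

variable {M : Type u} [AddCommMonoid M]

/-- The Riesz refinement property of a commutative monoid. -/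
def HasRefinement (M : Type u) [AddCommMonoid M] : Prop :=
  ∀ a b c d : M, a + b = c + d →
    ∃ p q r s : M, a = p + q ∧ b = r + s ∧ c = p + r ∧ d = q + s

variable [Subsingleton (AddUnits M)]

/-- Conicality enters through the instance on `AddUnits M`: the only additive unit is `0`, so an
irreducible is an atom. -/
theorem AddIrreducible.eq_zero_or_eq_zero_of_eq_add {x y z : M}
    (hx : AddIrreducible x) (h : x = y + z) :
    y = 0 ∨ z = 0 := by
  simpa only [isAddUnit_iff_eq_zero] using hx.isAddUnit_or_isAddUnit h

/-- Refine to `x = p + q = p + r`, `b = r + s`, `c = q + s`. If `p = 0`, then `q = r = x`. If `q =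
0`, then `x = x + r` forces `r = 0`. Either way `b = c`, although `M` is not assumed cancellative.
-/
theorem AddIrreducible.add_left_cancel_of_refinement (hM : HasRefinement M) {x b c : M}
    (hx : AddIrreducible x) (h : x + b = x + c) : b = c := by
  obtain ⟨p, q, r, s, h1, rfl, h3, rfl⟩ := hM _ _ _ _ h
  rcases hx.eq_zero_or_eq_zero_of_eq_add h1 with rfl | rfl
  · rw [zero_add] at h1 h3
    rw [← h1, ← h3]
  · rw [add_zero] at h1
    subst h1
    rcases hx.eq_zero_or_eq_zero_of_eq_add h3 with h | rfl
    · exact absurd h hx.ne_zero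
    · rfl

/-- Irreducibles are prime: refining `x + b = y + t.sum` puts all of `x` either into `y`, which then
equals `x`, or into `t.sum`, where induction applies. -/
theorem AddIrreducible.mem_of_add_eq_sum (hM : HasRefinement M) {x : M} (hx : AddIrreducible x)
    (t : Multiset M) (ht : ∀ y ∈ t, AddIrreducible y) {b : M} (h : x + b = t.sum) : x ∈ t := by
  induction t using Multiset.induction_on generalizing b with
  | empty =>
    rw [Multiset.sum_zero] at h
    exact absurd (add_eq_zero.1 h).1 hx.ne_zero
  | cons y t ih =>
    rw [Multiset.sum_cons] at h
    obtain ⟨p, q, r, s, h1, -, h3, h4⟩ := hM _ _ _ _ h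
    rcases hx.eq_zero_or_eq_zero_of_eq_add h1 with rfl | rfl
    · rw [zero_add] at h1
      subst h1
      exact Multiset.mem_cons_of_mem
        (ih (fun z hz => ht z (Multiset.mem_cons_of_mem hz)) h4.symm)
    · rw [add_zero] at h1
      subst h1
      rcases (ht y (Multiset.mem_cons_self y t)).eq_zero_or_eq_zero_of_eq_add h3 with h | rfl
      · exact absurd h hx.ne_zero
      · rw [h3, add_zero]
        exact Multiset.mem_cons_self _ _

/-- In a conical refinement monoid, decompositions into irreducible elements are unique. -/
theorem multiset_eq_of_sum_eq (hM : HasRefinement M) (s t : Multiset M)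
    (hs : ∀ y ∈ s, AddIrreducible y) (ht : ∀ y ∈ t, AddIrreducible y) (h : s.sum = t.sum) :
    s = t := by
  induction s using Multiset.induction_on generalizing t with
  | empty =>
    rw [Multiset.sum_zero] at h
    symm
    rw [Multiset.eq_zero_iff_forall_notMem]
    intro y hy
    obtain ⟨t', rfl⟩ := Multiset.exists_cons_of_mem hy
    rw [Multiset.sum_cons] at h
    exact (ht y hy).ne_zero (add_eq_zero.1 h.symm).1
  | cons x s ih =>
    have hx := hs x (Multiset.mem_cons_self x s)
    rw [Multiset.sum_cons] at h
    -- Primeness of `x` finds it in `t`; cancelling it from both sums leaves the induction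
    -- hypothesis.
    obtain ⟨t', rfl⟩ := Multiset.exists_cons_of_mem (hx.mem_of_add_eq_sum hM t ht h)
    rw [Multiset.sum_cons] at h
    rw [ih t' (fun y hy => hs y (Multiset.mem_cons_of_mem hy))
      (fun y hy => ht y (Multiset.mem_cons_of_mem hy))
      (hx.add_left_cancel_of_refinement hM h)]

/-- A conical refinement monoid generated by its irreducible elements is free on them. -/
theorem nonempty_addEquiv_finsupp (hM : HasRefinement M)
    (hgen : ∀ x : M, ∃ s : Multiset M, (∀ y ∈ s, AddIrreducible y) ∧ s.sum = x) :
    Nonempty (M ≃+ ({x : M // AddIrreducible x} →₀ ℕ)) := by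
  classical
  -- Multisets serve as the free commutative monoid: injectivity of `φ` is uniqueness of
  -- decompositions, surjectivity is `hgen`.
  let φ : Multiset {x : M // AddIrreducible x} →+ M :=
    Multiset.sumAddMonoidHom.comp (Multiset.mapAddMonoidHom Subtype.val)
  have hφ : ∀ s, φ s = (s.map Subtype.val).sum := fun _ => rfl
  have hmem : ∀ s : Multiset {x : M // AddIrreducible x},
      ∀ y ∈ s.map Subtype.val, AddIrreducible y := by
    intro s y hy
    obtain ⟨z, -, rfl⟩ := Multiset.mem_map.1 hy
    exact z.2
  have hbij : Function.Bijective φ := by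
    constructor
    · intro s t hst
      exact Multiset.map_injective Subtype.val_injective
        (multiset_eq_of_sum_eq hM _ _ (hmem s) (hmem t) hst)
    · intro x
      obtain ⟨s, hs, rfl⟩ := hgen x
      lift s to Multiset {x : M // AddIrreducible x} using hs
      exact ⟨s, rfl⟩
  exact ⟨(AddEquiv.ofBijective φ hbij).symm.trans Multiset.toFinsupp⟩

end RefinementMonoid

/-! ### Order ideals, relative complements and measures on idempotents -/

namespace InverseSemigroup

section Order

variable {S : Type u} [InverseSemigroup S]

theorem idem_of_le {x e : S} (he : e * e = e) (h : x ≤ e) : x * x = x := by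
  rw [le_iff] at h
  rw [h]
  exact idem_mul he (idem_d x)

theorem mul_eq_of_le_idem {x e : S} (he : e * e = e) (h : x ≤ e) : x * e = x := by
  obtain ⟨f, -, rfl⟩ := eq_idem_mul_of_le h
  rw [mul_assoc, he]

theorem mul_eq_of_le_idem' {x e : S} (he : e * e = e) (h : x ≤ e) : e * x = x := by
  rw [idem_comm he (idem_of_le he h), mul_eq_of_le_idem he h]

/-- Finiteness of order ideals only has to be tested on idempotents. -/
theorem isSemisimple_of_idem (h : ∀ e : S, e * e = e → {x : S | x ≤ e}.Finite) :
    IsSemisimple S := by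
  intro a
  -- Each `x ≤ a` is recovered as `a * (x⁻¹ * x)`, where `x⁻¹ * x ≤ a⁻¹ * a`.
  refine ((h _ (idem_d a)).image (a * ·)).subset fun x hx => ?_
  have hx' : x ≤ a := hx
  exact ⟨x⁻¹ * x, (mul_le_right x (inv_le_inv hx')).trans (mul_le_left a⁻¹ hx'),
    ((le_iff x a).1 hx').symm⟩

end Order

section Boolean

/-- The difference `e \ f`, described by `≤` alone: the Boolean structure on idempotents is tied to
the natural order only through its order relation. Disjointness is phrased without naming `⊥`. -/
theorem exists_relative_compl {α : Type u} [GeneralizedBooleanAlgebra α] {f e : α} (h : f ≤ e) :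
    ∃ g ≤ e, (∀ m x, m ≤ f → m ≤ g → m ≤ x) ∧ ∀ c, f ≤ c → g ≤ c → e ≤ c :=
  ⟨e \ f, sdiff_le, fun _ _ h1 h2 => (disjoint_sdiff_self_right h1 h2).trans bot_le,
    fun c h1 h2 => by
      rw [← sup_sdiff_cancel_right h]
      exact sup_le h1 h2⟩

variable {S : Type u} [BooleanInverseSemigroup S]

theorem orthogonal_of_idem {e f : S} (he : e * e = e) (hf : f * f = f) (h : e * f = 0) :
    Orthogonal e f := by
  rw [Orthogonal, inv_idem he, inv_idem hf, and_self, h]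

/-- Relative complements of idempotents. -/
theorem exists_compl {e f : S} (he : e * e = e) (hfe : f ≤ e) :
    ∃ g : S, g * g = g ∧ f * g = 0 ∧ IsLUB {f, g} e := by
  have hf := idem_of_le he hfe
  obtain ⟨B, hB⟩ := BooleanInverseSemigroup.idem_boolean (S := S)
  let e' : Idem S := ⟨e, he⟩
  let f' : Idem S := ⟨f, hf⟩
  obtain ⟨g', h1, h2, h3⟩ := @exists_relative_compl _ B f' e' ((hB f' e').2 hfe)
  have hg : g'.1 * g'.1 = g'.1 := g'.2
  have hge : g'.1 ≤ e := (hB g' e').1 h1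
  have hfg : f * g'.1 = 0 := by
    let m : Idem S := ⟨f * g'.1, idem_mul hf hg⟩
    exact eq_zero_of_le ((hB _ _).1 (h2 m ⟨0, zero_mul 0⟩ ((hB m f').2 (mul_idem_le hg f))
      ((hB m g').2 (idem_mul_le hf g'.1))))
  refine ⟨g', hg, hfg, ?_⟩
  -- The Boolean algebra gives a least upper bound among idempotents only. The join `c` taken in `S`
  -- lies below `e`, hence is idempotent, and so must equal `e`.
  obtain ⟨c, hc⟩ :=
    BooleanInverseSemigroup.exists_join _ _ (orthogonal_of_idem hf hg hfg).compatible
  have hce : c ≤ e := hc.2 (by rintro _ (rfl | rfl) <;> assumption)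
  let c' : Idem S := ⟨c, idem_of_le he hce⟩
  have hec : e ≤ c := (hB e' c').1 (h3 c' ((hB f' c').2 (hc.1 (Or.inl rfl)))
    ((hB g' c').2 (hc.1 (Or.inr rfl))))
  rwa [hce.antisymm hec] at hc

/-- A Boolean inverse semigroup is semisimple if its idempotents carry a strictly positive
natural-valued measure. -/
theorem isSemisimple_of_measure (μ : Idem S → ℕ) (hpos : ∀ e, μ e = 0 → e.1 = 0)
    (hadd : ∀ e f g : Idem S, e.1 * f.1 = 0 → IsLUB {e.1, f.1} g.1 → μ g = μ e + μ f) :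
    IsSemisimple S := by
  apply isSemisimple_of_idem
  suffices h : ∀ n, ∀ e : Idem S, μ e = n → {x : S | x ≤ e}.Finite from
    fun e he => h _ ⟨e, he⟩ rfl
  intro n
  induction n using Nat.strong_induction_on with
  | _ n ih =>
    rintro e rfl
    -- Either nothing lies strictly between `0` and `e`, or `e` splits as an orthogonal join of `f`
    -- and its complement `g`.
    by_cases hatom : ∀ f ≤ e.1, f = 0 ∨ f = e.1
    · exact (Set.toFinite {0, e.1}).subset hatom
    · push Not at hatom
      obtain ⟨f, hfe, hf0, hf⟩ := hatom
      have hfi := idem_of_le e.2 hfe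
      obtain ⟨g, hg, hfg, hlub⟩ := exists_compl e.2 hfe
      have hsum := hadd ⟨f, hfi⟩ ⟨g, hg⟩ e hfg hlub
      have hf1 : μ ⟨f, hfi⟩ ≠ 0 := fun h => hf0 (hpos _ h)
      -- If `g = 0`, the join `e` would be `f`. With both measures positive, each is smaller than `μ
      -- e`.
      have hg1 : μ ⟨g, hg⟩ ≠ 0 := fun h => by
        obtain rfl : g = 0 := hpos _ h
        exact hf (hfe.antisymm (hlub.2 (by
          rintro _ (rfl | rfl)
          · exact le_rfl
          · exact zero_le' _)))
      have hF := ih _ (by omega) ⟨f, hfi⟩ rfl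
      have hG := ih _ (by omega) ⟨g, hg⟩ rfl
      -- Injective because `x = x * e` is the join of `x * f` and `x * g`.
      refine Set.Finite.of_injOn (f := fun x => (x * f, x * g)) (t := {x | x ≤ f} ×ˢ {x | x ≤ g})
        (fun x hx => ?_) (fun x hx y hy hxy => ?_) (hF.prod hG)
      · have hx' := idem_of_le e.2 hx
        exact ⟨idem_mul_le hx' f, idem_mul_le hx' g⟩
      · have hc := (orthogonal_of_idem hfi hg hfg).compatible
        have h1 := BooleanInverseSemigroup.mul_join f g e.1 x hc hlub
        have h2 := BooleanInverseSemigroup.mul_join f g e.1 y hc hlub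
        rw [Prod.mk.injEq] at hxy
        rw [mul_eq_of_le_idem e.2 hx, hxy.1, hxy.2] at h1
        rw [mul_eq_of_le_idem e.2 hy] at h2
        exact h1.unique h2

end Boolean

end InverseSemigroup

/-! ### Finite order ideals and one-entry matrices -/

namespace RookMatrix

open InverseSemigroup

variable {ι : Type v} {S : Type u} [BooleanInverseSemigroup S]

/-- The order is entrywise, so `X ≤ A` vanishes off the finite support of `A` and is determined by a
point of a finite product of finite order ideals of `S`. -/
theorem finite_le (hS : IsSemisimple S) (A : RookMatrix ι S) :
    {X : RookMatrix ι S | X ≤ A}.Finite := by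
  have := A.finite_support.to_subtype
  refine Set.Finite.of_injOn
    (f := fun X (p : {p : ι × ι | A.entry p.1 p.2 ≠ 0}) => X.entry p.1.1 p.1.2)
    (t := Set.univ.pi fun p => {x | x ≤ A.entry p.1.1 p.1.2})
    (fun X hX p _ => (le_iff_entry X A).1 hX _ _) (fun X hX Y hY hXY => ?_)
    (Set.Finite.pi fun p => hS _)
  ext i j
  by_cases h : A.entry i j = 0
  · have h1 := (le_iff_entry X A).1 hX i j
    have h2 := (le_iff_entry Y A).1 hY i j
    rw [h] at h1 h2
    rw [eq_zero_of_le h1, eq_zero_of_le h2]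
  · exact congrFun hXY ⟨(i, j), h⟩

/-- The idempotent matrix with a single non-zero entry, on the diagonal. -/
def single [DecidableEq ι] (k : ι) (e : Idem S) : Idem (RookMatrix ι S) :=
  ⟨{ entry := fun i j => if i = k ∧ j = k then e.1 else 0
     row_orthogonal := fun i j l h => by
      by_cases hj : i = k ∧ j = k
      · rw [if_neg (c := i = k ∧ l = k) fun hl => h (hj.2.trans hl.2.symm), mul_zero]
      · rw [if_neg hj, inv_zero', zero_mul]
     col_orthogonal := fun i j l h => by
      by_cases hj : i = k ∧ l = k
      · rw [if_neg (c := j = k ∧ l = k) fun hl => h (hj.1.trans hl.1.symm), inv_zero', mul_zero]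
      · rw [if_neg hj, zero_mul]
     finite_support := (Set.finite_singleton (k, k)).subset fun p hp => by
      by_contra hne
      exact hp (if_neg fun h => hne (Prod.ext h.1 h.2)) },
   (idem_iff _).2 ⟨fun i j h => if_neg fun h' => h (h'.1.trans h'.2.symm), fun i => by
    dsimp only
    split_ifs
    · exact e.2
    · exact zero_mul 0⟩⟩

variable [DecidableEq ι]

theorem single_entry (k : ι) (e : Idem S) (i j : ι) :
    (single k e).1.entry i j = if i = k ∧ j = k then e.1 else 0 := rfl

theorem single_entry_self (k : ι) (e : Idem S) : (single k e).1.entry k k = e.1 :=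
  if_pos ⟨rfl, rfl⟩

/-- With `isLUB_single_pair`, this makes `e ↦ [single 0 e]` additive on orthogonal joins. -/
theorem orthogonal_single (k : ι) {e f : Idem S} (h : e.1 * f.1 = 0) :
    Orthogonal (single k e).1 (single k f).1 := by
  rw [orthogonal_idem_iff (single k e).2 (single k f).2]
  ext i j
  rw [mul_diag (idem_entry (single k f).2), zero_entry, single_entry, single_entry]
  split_ifs
  · exact h
  · exact mul_zero _
  · exact zero_mul _
  · exact zero_mul _

theorem isLUB_single_pair (k : ι) {e f g : Idem S} (h : IsLUB {e.1, f.1} g.1) :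
    IsLUB {(single k e).1, (single k f).1} (single k g).1 := by
  refine isLUB_of_entry fun i j => ?_
  simp only [single_entry]
  split_ifs
  · exact h
  · rw [Set.pair_eq_singleton]
    exact isLUB_singleton

end RookMatrix

/-! ### Conicality, refinement and generation of the type monoid -/

namespace TypeMonoid

open InverseSemigroup RookMatrix

variable {S : Type u} [BooleanInverseSemigroup S]

theorem mk_surjective : Function.Surjective (mk : Idem (RookMatrix ℕ S) → TypeMonoid S) :=
  Quotient.exists_rep

theorem mk_eq_zero_iff {e : Idem (RookMatrix ℕ S)} : mk e = 0 ↔ e.1 = 0 := by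
  constructor
  · intro h
    obtain ⟨A, h1, h2⟩ := mk_eq_iff.1 (h.trans zero_def)
    have hA : A = 0 := by
      rw [← InverseSemigroup.mul_inv_mul A, h2]
      exact zero_mul A
    rw [← h1, hA, mul_zero]
  · intro h
    rw [zero_def]
    exact congrArg mk (Subtype.ext h)

/-- A decomposition of `[e]` in the type monoid comes from a decomposition of `e`. -/
theorem exists_split {e : Idem (RookMatrix ℕ S)} {y z : TypeMonoid S} (h : mk e = y + z) :
    ∃ e₁ e₂ : Idem (RookMatrix ℕ S), Orthogonal e₁.1 e₂.1 ∧ IsLUB {e₁.1, e₂.1} e.1 ∧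
      mk e₁ = y ∧ mk e₂ = z := by
  obtain ⟨f₁, f₂, g, hort, hlub, rfl, rfl, hg⟩ := add_eq_iff.1 h.symm
  obtain ⟨A, h1, h2⟩ := mk_eq_iff.1 hg.symm
  have hle₁ : f₁.1 ≤ g.1 := hlub.1 (Or.inl rfl)
  have hle₂ : f₂.1 ≤ g.1 := hlub.1 (Or.inr rfl)
  -- `A` witnesses that `e` and `g` are `𝒟`-related, so conjugation by `A` carries idempotents below
  -- `g` to idempotents below `e`; the restriction `f * A` keeps the class.
  have hd : ∀ f : Idem (RookMatrix ℕ S), f.1 ≤ g.1 →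
      DRel (A⁻¹ * f.1 * A) f.1 := fun f hf => by
    have hf2 : f.1 * f.1 = f.1 := f.2
    refine ⟨f.1 * A, ?_, ?_⟩
    · rw [mul_inv', inv_idem f.2]
      calc A⁻¹ * f.1 * (f.1 * A) = A⁻¹ * (f.1 * f.1) * A := by simp only [mul_assoc]
        _ = _ := by rw [hf2]
    · rw [mul_inv', inv_idem f.2]
      calc f.1 * A * (A⁻¹ * f.1) = f.1 * (A * A⁻¹) * f.1 := by simp only [mul_assoc]
        _ = f.1 := by rw [h2, mul_eq_of_le_idem g.2 hf, hf2]
  refine ⟨⟨A⁻¹ * f₁.1 * A, idem_conj f₁.2 A⟩, ⟨A⁻¹ * f₂.1 * A, idem_conj f₂.2 A⟩, ?_, ?_,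
    mk_eq_iff.2 (hd f₁ hle₁), mk_eq_iff.2 (hd f₂ hle₂)⟩
  · rw [orthogonal_idem_iff (idem_conj f₁.2 A) (idem_conj f₂.2 A)]
    calc A⁻¹ * f₁.1 * A * (A⁻¹ * f₂.1 * A) = A⁻¹ * (f₁.1 * (A * A⁻¹) * f₂.1) * A := by
          simp only [mul_assoc]
      _ = 0 := by
          rw [h2, mul_eq_of_le_idem g.2 hle₁, (orthogonal_idem_iff f₁.2 f₂.2).1 hort, mul_zero,
            zero_mul]
  · have h3 := RookMatrix.join_mul (orthogonal_mul_left A⁻¹ hort)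
      (RookMatrix.mul_join hort hlub A⁻¹) A
    rwa [← h2, ← mul_assoc, InverseSemigroup.inv_mul_inv, h1] at h3

/-- A decomposition of `[0]` lifts to idempotents below `0`, so its summands vanish. -/
instance instSubsingletonAddUnits : Subsingleton (AddUnits (TypeMonoid S)) := by
  suffices h : ∀ u : AddUnits (TypeMonoid S), (u : TypeMonoid S) = 0 from
    ⟨fun u v => AddUnits.ext ((h u).trans (h v).symm)⟩
  intro u
  have h0 : mk ⟨0, zero_mul 0⟩ = (u : TypeMonoid S) + ((-u : AddUnits _) : TypeMonoid S) := by
    rw [AddUnits.add_neg, zero_def]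
  obtain ⟨e, f, -, hlub, he, -⟩ := exists_split h0
  rw [← he, mk_eq_zero_iff]
  exact eq_zero_of_le (hlub.1 (Or.inl rfl))

/-- Both sums can be realized as orthogonal splittings of one idempotent `g`; the products `eᵢ * fⱼ`
are then the common refinement. -/
theorem hasRefinement : HasRefinement (TypeMonoid S) := by
  intro a b c d h
  obtain ⟨e₁, e₂, g, he, hg, rfl, rfl, hgs⟩ := isSum_add a b
  obtain ⟨f₁, f₂, hf, hg', rfl, rfl⟩ := exists_split (hgs.trans h)
  let P (e f : Idem (RookMatrix ℕ S)) : Idem (RookMatrix ℕ S) := ⟨e.1 * f.1, idem_mul e.2 f.2⟩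
  have row : ∀ e : Idem (RookMatrix ℕ S), e.1 ≤ g.1 → mk e = mk (P e f₁) + mk (P e f₂) := by
    intro e hle
    have h1 := RookMatrix.mul_join hf hg' e.1
    rw [mul_eq_of_le_idem g.2 hle] at h1
    have h2 := orthogonal_mul_left e.1 hf
    exact (mk_add_mk (e := P e f₁) (f := P e f₂) h2 h1).symm
  have col : ∀ f : Idem (RookMatrix ℕ S), f.1 ≤ g.1 → mk f = mk (P e₁ f) + mk (P e₂ f) := by
    intro f hle
    have h1 := RookMatrix.join_mul he hg f.1
    rw [mul_eq_of_le_idem' g.2 hle] at h1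
    have h2 := orthogonal_mul_right f.1 he
    exact (mk_add_mk (e := P e₁ f) (f := P e₂ f) h2 h1).symm
  exact ⟨mk (P e₁ f₁), mk (P e₁ f₂), mk (P e₂ f₁), mk (P e₂ f₂), row e₁ (hg.1 (Or.inl rfl)),
    row e₂ (hg.1 (Or.inr rfl)), col f₁ (hg'.1 (Or.inl rfl)), col f₂ (hg'.1 (Or.inr rfl))⟩

theorem lt_of_isLUB {e f g : Idem (RookMatrix ℕ S)} (h : Orthogonal e.1 f.1)
    (hg : IsLUB {e.1, f.1} g.1) (hf : f.1 ≠ 0) : e.1 < g.1 := by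
  refine lt_of_le_of_ne (hg.1 (Or.inl rfl)) fun heq => hf ?_
  have hle : f.1 ≤ e.1 := heq ▸ hg.1 (Or.inr rfl)
  rw [← mul_eq_of_le_idem' e.2 hle]
  exact (orthogonal_idem_iff e.2 f.2).1 h

/-- Strong induction on the number of matrices below a representative `e`. A reducible nonzero class
splits into two nonzero classes, and the lifted pieces lie strictly below `e`. -/
theorem exists_irreducible_decomposition (hS : IsSemisimple S) (x : TypeMonoid S) :
    ∃ s : Multiset (TypeMonoid S), (∀ y ∈ s, AddIrreducible y) ∧ s.sum = x := by
  obtain ⟨e, rfl⟩ := mk_surjective x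
  induction h : {X : RookMatrix ℕ S | X ≤ e.1}.ncard using Nat.strong_induction_on
    generalizing e with
  | _ n ih =>
    subst h
    by_cases h0 : mk e = 0
    · exact ⟨0, by simp, by rw [h0, Multiset.sum_zero]⟩
    by_cases hirr : AddIrreducible (mk e)
    · exact ⟨{mk e}, by simpa using hirr, Multiset.sum_singleton _⟩
    have hsplit : ∃ y z, mk e = y + z ∧ y ≠ 0 ∧ z ≠ 0 := by
      by_contra hcon
      push Not at hcon
      refine hirr ⟨by rwa [isAddUnit_iff_eq_zero], fun y z hyz => ?_⟩
      rw [isAddUnit_iff_eq_zero, isAddUnit_iff_eq_zero]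
      by_cases hy : y = 0
      · exact Or.inl hy
      · exact Or.inr (hcon y z hyz hy)
    obtain ⟨y, z, hyz, hy, hz⟩ := hsplit
    obtain ⟨e₁, e₂, hort, hlub, rfl, rfl⟩ := exists_split hyz
    have hlt : ∀ f : Idem (RookMatrix ℕ S), f.1 < e.1 →
        {X : RookMatrix ℕ S | X ≤ f.1}.ncard < {X : RookMatrix ℕ S | X ≤ e.1}.ncard :=
      fun f hf => Set.ncard_lt_ncard (Set.Iic_ssubset_Iic.2 hf) (finite_le hS e.1)
    obtain ⟨s, hs, hs'⟩ := ih _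
      (hlt e₁ (lt_of_isLUB hort hlub fun h => hz (mk_eq_zero_iff.2 h))) e₁ rfl
    obtain ⟨t, ht, ht'⟩ := ih _
      (hlt e₂ (lt_of_isLUB hort.symm (Set.pair_comm e₁.1 e₂.1 ▸ hlub)
        fun h => hy (mk_eq_zero_iff.2 h))) e₂ rfl
    refine ⟨s + t, fun w hw => ?_, by rw [Multiset.sum_add, hs', ht', hyz]⟩
    exact (Multiset.mem_add.1 hw).elim (hs w) (ht w)

/-! ### Passing between `S` and its type monoid -/

theorem mk_single_eq_zero_iff {e : Idem S} : mk (single 0 e) = 0 ↔ e.1 = 0 := by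
  rw [mk_eq_zero_iff]
  constructor
  · intro h
    rw [← single_entry_self (0 : ℕ) e, h, zero_entry]
  · intro h
    ext i j
    rw [single_entry, h, ite_self, zero_entry]

instance instNontrivial [Nontrivial S] : Nontrivial (TypeMonoid S) := by
  obtain ⟨a, ha⟩ := exists_ne (0 : S)
  refine ⟨mk (single 0 ⟨a⁻¹ * a, idem_d a⟩), 0, fun h => ha ?_⟩
  have h1 : a⁻¹ * a = 0 := mk_single_eq_zero_iff.1 h
  rw [← InverseSemigroup.mul_inv_mul a, mul_assoc, h1, mul_zero]

/-- The degree of `φ [single 0 e]` is the required measure: degree is additive and, with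
coefficients in `ℕ`, vanishes only at `0`. -/
theorem isSemisimple_of_addEquiv {X : Type v} (φ : TypeMonoid S ≃+ (X →₀ ℕ)) :
    IsSemisimple S := by
  refine isSemisimple_of_measure (fun e => (φ (mk (single 0 e))).degree) (fun e he => ?_)
    fun e f g hef hg => ?_
  · rwa [Finsupp.degree_eq_zero_iff, map_eq_zero_iff φ φ.injective, mk_single_eq_zero_iff] at he
  · rw [← mk_add_mk (orthogonal_single 0 hef) (isLUB_single_pair 0 hg), map_add, map_add]

/-- A nonzero class exists, and its decomposition cannot be the empty sum. -/
theorem nonempty_irreducible [Nontrivial S] (hS : IsSemisimple S) :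
    Nonempty {x : TypeMonoid S // AddIrreducible x} := by
  obtain ⟨x, hx⟩ := exists_ne (0 : TypeMonoid S)
  obtain ⟨s, hs, rfl⟩ := exists_irreducible_decomposition hS x
  obtain ⟨y, hy⟩ := Multiset.exists_mem_of_ne_zero fun h : s = 0 => hx (by rw [h]; rfl)
  exact ⟨⟨y, hs y hy⟩⟩

end TypeMonoid

theorem theorem6p11 {S : Type u} [BooleanInverseSemigroup S] [Nontrivial S] :
    (∃ X : Type u, Nonempty X ∧ Nonempty (TypeMonoid S ≃+ (X →₀ ℕ))) ↔
      InverseSemigroup.IsSemisimple S := by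
  constructor
  · rintro ⟨X, -, ⟨φ⟩⟩
    exact TypeMonoid.isSemisimple_of_addEquiv φ
  · intro hS
    -- The basis is the set of irreducible classes, which lives in the same universe as `S`.
    exact ⟨_, TypeMonoid.nonempty_irreducible hS, nonempty_addEquiv_finsupp
      TypeMonoid.hasRefinement (TypeMonoid.exists_irreducible_decomposition hS)⟩
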